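/- Let $M$ be an oriented smooth Riemannian manifold (possibly with boundary) of dimension $n\ge 1$, with Levi-Civita connection $\nabla$ and Riemannian volume form $\mathcal V\in\Omega^n(M)$. For a $C^1$ vector field $u$ let $\nabla u\in\Gamma(TM)\otimes\Omega^1(M)$ be the vector-valued $1$-form $X\mapsto\nabla_X u$, and let $\operatorname{div}(u)$ be the function determined by $\mathrm d(\iota_u\mathcal V)=\operatorname{div}(u)\,\mathcal V$ (equivalently $\mathcal L_u\mathcal V=\operatorname{div}(u)\,\mathcal V$). Identify an $n$-form $\omega$ with the covector-valued $(n-1)$-form $v\mapsto\iota_v\omega$ in $\Omega^1(M)\otimes\Omega^{n-1}(M)$, and for a vector-valued $1$-form and a covector-valued $(n-1)$-form let $\dot\wedge$ be the duality pairing on the tensor values combined with the wedge product of the forms, i.e. $(w\otimes\alpha)\,\dot\wedge\,(\gamma\otimes\beta)=\gamma(w)\,\alpha\wedge\beta$, with values in $\Omega^n(M)$. Then for every $C^1$ function $f$ and every $C^1$ vector field $u$ on $M$, $$\nabla u\,\dot\wedge\, f\mathcal V \;=\; f\,\operatorname{div}(u)\,\mathcal V .$$ -/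

import Mathlib

open Bundle Manifold Module
open scoped ContDiff Topology

noncomputable section

namespace RiemForms

/-! ### Differential forms and tensor-valued forms on a manifold

Everything in this section is independent of a metric. The tangent space `TangentSpace I x` is, by
definition, a copy of the model space `E`; the arguments `(E := E)` below only say that its
topology (to which the continuity of multilinear maps refers) is the one of `E`. -/

section Forms

variable {E : Type*} [NormedAddCommGroup E] [NormedSpace ℝ E]
  {H : Type*} [TopologicalSpace H] (I : ModelWithCorners ℝ E H)
  (M : Type*) [TopologicalSpace M] [ChartedSpace H M]

/-- A (not necessarily smooth) differential `k`-form on `M`. -/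
abbrev DiffForm (k : ℕ) := (x : M) → (TangentSpace I x) [⋀^Fin k]→L[ℝ] ℝ

/-- A vector-valued 1-form, i.e. a section of `TM ⊗ T*M = Hom(TM, TM)`: the elementary tensor
`w ⊗ α` is the map `v ↦ α v • w`. -/
abbrev VectorOneForm := (x : M) → (TangentSpace I x) →L[ℝ] (TangentSpace I x)

/-- A covector-valued `k`-form, i.e. a section of `T*M ⊗ Λᵏ T*M = Hom(TM, Λᵏ T*M)`: the elementary
tensor `α ⊗ β` is the map `v ↦ α v • β`. So the linear argument belongs to the first leg
(the covector value) and the `k` alternating arguments to the second leg. -/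
abbrev CovectorForm (k : ℕ) :=
  (x : M) → (TangentSpace I x) →L[ℝ] (TangentSpace I x) [⋀^Fin k]→L[ℝ] ℝ

variable {I M}

/-- Product `f η` of a function and a differential form. -/
def funMul {k : ℕ} (f : M → ℝ) (η : DiffForm I M k) : DiffForm I M k := fun x => f x • η x

/-- Interior product `ι_u η = η(u, ·, …, ·)`. -/
def interior {k : ℕ} (u : (x : M) → TangentSpace I x) (η : DiffForm I M (k + 1)) :
    DiffForm I M k :=
  fun x => ContinuousAlternatingMap.curryLeft (E := E) (η x) (u x)

/-- Identification of a `(k+1)`-form with the covector-valued `k`-form whose first leg is the first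
argument: `v ↦ η(v, ·, …, ·)`. -/
def topToCovector {k : ℕ} (η : DiffForm I M (k + 1)) : CovectorForm I M k :=
  fun x => ContinuousAlternatingMap.curryLeft (E := E) (η x)

/-- The dot-wedge `A ⩑ B` of a vector-valued 1-form and a covector-valued `k`-form: duality pairing
on the first legs, wedge product on the second legs. So `(w ⊗ α) ⩑ (γ ⊗ β) = γ(w) α ∧ β`, that is
`(A ⩑ B)(v₀, …, vₖ) = ∑ᵢ (-1)ⁱ B(A vᵢ)(v₀, …, v̂ᵢ, …, vₖ)`. -/
def dotWedge {k : ℕ} (A : VectorOneForm I M) (B : CovectorForm I M k) : DiffForm I M (k + 1) :=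
  fun x => ContinuousAlternatingMap.alternatizeUncurryFin (E := E) ((B x).comp (A x))

variable (I) in
/-- The coordinate expression of a `k`-form in the preferred chart `φ` at `x₀`, that is the
pullback of the form by the inverse of `φ`, a form on (a subset of) the model space `E`. -/
def formInChart {k : ℕ} (η : DiffForm I M k) (x₀ : M) (y : E) : E [⋀^Fin k]→L[ℝ] ℝ :=
  (η ((extChartAt I x₀).symm y)).compContinuousLinearMap
    (mfderivWithin 𝓘(ℝ, E) I (extChartAt I x₀).symm (Set.range I) y)

/-- The exterior derivative of a differential form on a manifold (possibly with boundary): at `x`,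
take the exterior derivative of the coordinate expression in the preferred chart `φ` at `x`, and
pull it back by `φ`. -/
def extDerivM {k : ℕ} (η : DiffForm I M k) : DiffForm I M (k + 1) := fun x =>
  ContinuousAlternatingMap.compContinuousLinearMap (M := E) (M' := TangentSpace I x)
    (extDerivWithin (formInChart I η x) (Set.range I) (extChartAt I x x))
    (mfderiv I 𝓘(ℝ, E) (extChartAt I x) x)

end Forms

/-! ### Oriented Riemannian manifolds -/

section Riemannian

variable {E : Type*} [NormedAddCommGroup E] [NormedSpace ℝ E] [FiniteDimensional ℝ E]
  {H : Type*} [TopologicalSpace H] (I : ModelWithCorners ℝ E H)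
  (M : Type*) [TopologicalSpace M] [ChartedSpace H M] [IsManifold I ∞ M]

instance tangentFiniteDimensional (x : M) : FiniteDimensional ℝ (TangentSpace I x) :=
  inferInstanceAs (FiniteDimensional ℝ E)

instance tangentFinrank (n : ℕ) [h : Fact (finrank ℝ E = n)] (x : M) :
    Fact (finrank ℝ (TangentSpace I x) = n) := h

/-- An orientation of the `n`-dimensional manifold `M`: a choice of orientation of each tangent
space which is locally constant when read in the local trivializations of the tangent bundle
given by the charts. -/
structure ManifoldOrientation (n : ℕ) where
  /-- the orientation of each tangent space -/
  at_point : (x : M) → Orientation ℝ (TangentSpace I x) (Fin n)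
  locally_constant : ∀ x₀ : M, ∃ o₀ : Orientation ℝ E (Fin n), ∀ᶠ x in 𝓝 x₀,
    ∀ hx : x ∈ (trivializationAt E (TangentSpace I) x₀).baseSet,
      Orientation.map (Fin n)
        ((trivializationAt E (TangentSpace I) x₀).linearEquivAt ℝ x hx) (at_point x) = o₀

variable {I M} [RiemannianBundle (fun x : M => TangentSpace I x)]
  {m : ℕ} [Fact (finrank ℝ E = m + 1)]

/-- The Riemannian volume form `𝒱` of an oriented Riemannian manifold: at each point, the volume
form of the tangent space, which is `1` on positively oriented orthonormal bases. -/
def volForm (o : ManifoldOrientation I M (m + 1)) : DiffForm I M (m + 1) := fun x =>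
  AlternatingMap.mkContinuous (o.at_point x).volumeForm 1
    (fun v => by simpa using (o.at_point x).abs_volumeForm_apply_le v)

/-- The divergence of a vector field `u` on an oriented Riemannian manifold: the function `div u`
such that `d (ι_u 𝒱) = div(u) 𝒱` for the volume form `𝒱`, see `extDerivM_interior_volForm`.
It is the quotient of the values of these two top-degree forms on any basis of the tangent space. -/
def divergence (o : ManifoldOrientation I M (m + 1)) (u : (x : M) → TangentSpace I x) (x : M) : ℝ :=
  let b : Basis (Fin (m + 1)) ℝ (TangentSpace I x) :=
    finBasisOfFinrankEq ℝ (TangentSpace I x) Fact.out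
  extDerivM (interior u (volForm o)) x b / volForm o x b

theorem volForm_basis_ne_zero (o : ManifoldOrientation I M (m + 1)) (x : M)
    (b : Basis (Fin (m + 1)) ℝ (TangentSpace I x)) : volForm o x b ≠ 0 := by
  have h : finrank ℝ (TangentSpace I x) = m + 1 := Fact.out
  let e := (o.at_point x).finOrthonormalBasis m.succ_pos h
  have he : (o.at_point x).volumeForm = e.toBasis.det :=
    (o.at_point x).volumeForm_robust e ((o.at_point x).finOrthonormalBasis_orientation _ _)
  change (o.at_point x).volumeForm b ≠ 0
  rw [he]
  exact (e.toBasis.isUnit_det b).ne_zero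

/-- The characteristic property of the divergence: `d (ι_u 𝒱) = div(u) 𝒱`. -/
theorem extDerivM_interior_volForm (o : ManifoldOrientation I M (m + 1))
    (u : (x : M) → TangentSpace I x) :
    extDerivM (interior u (volForm o)) = funMul (divergence o u) (volForm o) := by
  funext x
  let b : Basis (Fin (m + 1)) ℝ (TangentSpace I x) :=
    finBasisOfFinrankEq ℝ (TangentSpace I x) Fact.out
  have hb : volForm o x b ≠ 0 := volForm_basis_ne_zero o x b
  have key : ∀ (η : (TangentSpace I x) [⋀^Fin (m + 1)]→L[ℝ] ℝ) (v : Fin (m + 1) → TangentSpace I x),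
      η v = η b * b.det v := fun η v => by
    have := congrArg (fun g => g v) (η.toAlternatingMap.eq_smul_basis_det b)
    simpa using this
  ext v
  have hdiv : divergence o u x = extDerivM (interior u (volForm o)) x b / volForm o x b := rfl
  change extDerivM (interior u (volForm o)) x v = divergence o u x * volForm o x v
  rw [hdiv, key (volForm o x) v, key (extDerivM (interior u (volForm o)) x) v]
  field_simp

variable [IsContMDiffRiemannianBundle I ∞ E (fun x : M => TangentSpace I x)]

/-- A connection on the tangent bundle is the Levi-Civita connection if it is compatible with the
metric and torsion-free. -/
def IsLeviCivita (nabla : CovariantDerivative I E (fun x : M => TangentSpace I x)) : Prop :=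
  @CovariantDerivative.IsMetricCompatible E _ _ H _ I M _ _ E _ _ (fun x : M => TangentSpace I x)
    _ (fun _ => inferInstance) (fun _ => inferInstance) _ nabla _ _ _ _ ∧
  nabla.torsion = 0

end Riemannian

end RiemForms

end

/-- For a top-degree form `η` and an endomorphism `A`, the alternatization of
`v ↦ η (A v, ·, …, ·)` is `tr A • η`. -/
theorem ContinuousAlternatingMap.alternatizeUncurryFin_curryLeft_comp_eq_trace_smul
    {E : Type*} [NormedAddCommGroup E] [NormedSpace ℝ E] {m : ℕ}
    (b : Basis (Fin (m + 1)) ℝ E) (η : E [⋀^Fin (m + 1)]→L[ℝ] ℝ) (A : E →L[ℝ] E) :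
    ContinuousAlternatingMap.alternatizeUncurryFin (η.curryLeft.comp A)
      = LinearMap.trace ℝ E A • η := by
  apply ContinuousAlternatingMap.toAlternatingMap_injective
  refine Basis.ext_alternating b fun v hv => ?_
  have hterm : ∀ i : Fin (m + 1), (-1 : ℤ) ^ i.val • η.curryLeft (A (b (v i)))
      (Fin.removeNth i fun j => b (v j)) = b.repr (A (b (v i))) (v i) * η (fun j => b (v j)) := by
    intro i
    have hsum := b.sum_repr (A (b (v i)))
    have h1 : (-1 : ℤ) ^ i.val • η.curryLeft (A (b (v i)))
        (Fin.removeNth i fun j => b (v j))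
        = η (Function.update (fun j => b (v j)) i (A (b (v i)))) := by
      rw [← Fin.insertNth_removeNth, ContinuousAlternatingMap.map_insertNth]
      rfl
    have hbij : Function.Bijective v := Finite.injective_iff_bijective.1 hv
    rw [h1]
    conv_lhs => rw [← hsum]
    have h2 := η.toMultilinearMap.map_update_sum Finset.univ i
      (fun j => b.repr (A (b (v i))) j • b j) (fun j => b (v j))
    refine h2.trans ?_
    rw [Finset.sum_eq_single (v i)]
    · have h3 := η.toMultilinearMap.map_update_smul (fun j => b (v j)) i
        (b.repr (A (b (v i))) (v i)) (b (v i))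
      refine h3.trans ?_
      rw [Function.update_eq_self]
      rfl
    · intro k _ hk
      obtain ⟨l, rfl⟩ := hbij.2 k
      have hl : l ≠ i := fun h => hk (by rw [h])
      have h3 := η.toMultilinearMap.map_update_smul (fun j => b (v j)) i
        (b.repr (A (b (v i))) (v l)) (b (v l))
      refine h3.trans ?_
      have h4 : η (Function.update (fun j => b (v j)) i (b (v l))) = 0 :=
        η.map_eq_zero_of_eq _ (by simp [Function.update_of_ne hl]) hl
      exact (congrArg _ h4).trans (smul_zero _)
    · simp
  have htr : LinearMap.trace ℝ E A = ∑ i, b.repr (A (b i)) i := by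
    rw [LinearMap.trace_eq_matrix_trace ℝ b]
    simp [Matrix.trace, LinearMap.toMatrix_apply]
  change ContinuousAlternatingMap.alternatizeUncurryFin (η.curryLeft.comp A) (fun j => b (v j))
    = LinearMap.trace ℝ E A * η (fun j => b (v j))
  rw [ContinuousAlternatingMap.alternatizeUncurryFin_apply, htr, Finset.sum_mul]
  refine (Finset.sum_congr rfl fun i _ => ?_).trans
    ((Equiv.ofBijective v (Finite.injective_iff_bijective.1 hv)).sum_comp
      fun i => b.repr (A (b i)) i * η (fun j => b (v j)))
  exact hterm i

theorem ContinuousAlternatingMap.eq_apply_basis_smul {E : Type*} [NormedAddCommGroup E]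
    [NormedSpace ℝ E] {n : ℕ} (b : Basis (Fin n) ℝ E) (η ζ : E [⋀^Fin n]→L[ℝ] ℝ) (hζ : ζ b = 1) :
    η = η b • ζ := by
  apply ContinuousAlternatingMap.toAlternatingMap_injective
  have hη := AlternatingMap.eq_smul_basis_det b η.toAlternatingMap
  have hζ' := AlternatingMap.eq_smul_basis_det b ζ.toAlternatingMap
  change η.toAlternatingMap = η b • ζ.toAlternatingMap
  rw [hη, hζ']
  change η b • b.det = η b • ζ b • b.det
  rw [hζ, one_smul]

/-- The exterior derivative of `ι_U (g η)`, with `η` a constant top-degree form and `g y = 1`. -/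
theorem extDerivWithin_smul_curryLeft
    {E : Type*} [NormedAddCommGroup E] [NormedSpace ℝ E] {m : ℕ}
    (b : Basis (Fin (m + 1)) ℝ E) (η : E [⋀^Fin (m + 1)]→L[ℝ] ℝ) {g : E → ℝ} {U : E → E}
    {s : Set E} {y : E} {l : E →L[ℝ] ℝ} {U' : E →L[ℝ] E} (hs : UniqueDiffWithinAt ℝ s y)
    (hg : HasFDerivWithinAt g l s y) (hU : HasFDerivWithinAt U U' s y) (hgy : g y = 1) :
    extDerivWithin (fun z => g z • η.curryLeft (U z)) s y
      = (LinearMap.trace ℝ E U' + l (U y)) • η := by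
  have h := hg.fun_smul (η.curryLeft.hasFDerivAt.comp_hasFDerivWithinAt y hU)
  have hfin : FiniteDimensional ℝ E := b.finiteDimensional_of_finite
  have heq : g y • η.curryLeft.comp U' + l.smulRight (η.curryLeft (U y))
      = η.curryLeft.comp (U' + l.smulRight (U y)) := by
    ext v w
    simp [hgy]
  have htr : LinearMap.trace ℝ E ((U' + l.smulRight (U y) : E →L[ℝ] E) : E →ₗ[ℝ] E)
      = LinearMap.trace ℝ E U' + l (U y) := by
    have hadd : ((U' + l.smulRight (U y) : E →L[ℝ] E) : E →ₗ[ℝ] E)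
      = (U' : E →ₗ[ℝ] E) + (l : E →ₗ[ℝ] ℝ).smulRight (U y) := rfl
    rw [hadd, map_add]
    simp
  rw [extDerivWithin]
  refine (congrArg _ ((h.fderivWithin hs).trans heq)).trans ?_
  rw [ContinuousAlternatingMap.alternatizeUncurryFin_curryLeft_comp_eq_trace_smul b, htr]

theorem HasFDerivWithinAt.matrix_det_of_eq_one {E : Type*} [NormedAddCommGroup E]
    [NormedSpace ℝ E] {ι : Type*} [Fintype ι] [DecidableEq ι] {a : E → Matrix ι ι ℝ}
    {a' : ι → ι → E →L[ℝ] ℝ} {s : Set E} {y : E}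
    (ha : ∀ i j, HasFDerivWithinAt (fun z => a z i j) (a' i j) s y) (h1 : a y = 1) :
    HasFDerivWithinAt (fun z => (a z).det) (∑ i, a' i i) s y := by
  let D : ContinuousMultilinearMap ℝ (fun _ : ι => ι → ℝ) ℝ :=
    { Matrix.detRowAlternating.toMultilinearMap with cont := continuous_id.matrix_det }
  have hrow : ∀ i, HasFDerivWithinAt (fun z => a z i) (ContinuousLinearMap.pi (a' i)) s y :=
    fun i => hasFDerivWithinAt_pi.2 (ha i)
  refine (HasFDerivWithinAt.multilinear_comp D hrow).congr_fderiv ?_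
  refine Finset.sum_congr rfl fun i _ => ?_
  ext v
  change (Matrix.updateRow (a y) i fun j => a' i j v).det = a' i i v
  rw [h1, ← Matrix.cramer_transpose_apply]
  simp

theorem Orientation.volumeForm_eq_sqrt_det_gram {E : Type*} [NormedAddCommGroup E]
    [InnerProductSpace ℝ E] {n : ℕ} [Fact (finrank ℝ E = n)] (o : Orientation ℝ E (Fin n))
    (hn : 0 < n) (v : Basis (Fin n) ℝ E) (hv : v.orientation = o) :
    o.volumeForm v = Real.sqrt (Matrix.gram ℝ v).det := by
  have h : finrank ℝ E = n := Fact.out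
  set e := o.finOrthonormalBasis hn h
  have hor : e.toBasis.orientation = o := o.finOrthonormalBasis_orientation _ _
  have he : o.volumeForm = e.toBasis.det := o.volumeForm_robust e hor
  have hpos : 0 < o.volumeForm v := by
    rw [he]
    exact (Basis.orientation_eq_iff_det_pos _ _).1 (hor.trans hv.symm)
  rw [eq_comm, Real.sqrt_eq_iff_mul_self_eq_of_pos hpos, he, Basis.det_apply]
  nth_rewrite 1 [← Matrix.det_transpose]
  rw [← Matrix.det_mul]
  congr 1
  ext i j
  simp [Matrix.mul_apply, Matrix.gram_apply, Basis.toMatrix_apply,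
    OrthonormalBasis.repr_apply_apply]
  rw [← e.sum_inner_mul_inner]
  simp [real_inner_comm]

namespace RiemForms

section

variable {E : Type*} [NormedAddCommGroup E] [NormedSpace ℝ E]
  {H : Type*} [TopologicalSpace H] {I : ModelWithCorners ℝ E H}
  {M : Type*} [TopologicalSpace M] [ChartedSpace H M] [IsManifold I ∞ M]

/-- The extensions of a basis of `T_x M` form a basis of the nearby tangent spaces, whose coordinates
in the trivialization at `x` are constant. -/
theorem exists_basis_extend (x : M) {n : ℕ} (e : Basis (Fin n) ℝ (TangentSpace I x)) {x' : M}
    (hx' : x' ∈ (trivializationAt E (TangentSpace I) x).baseSet) :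
    ∃ v : Basis (Fin n) ℝ (TangentSpace I x'),
      (∀ i, v i = FiberBundle.extend E (e i) x') ∧
      v.map ((trivializationAt E (TangentSpace I) x).linearEquivAt ℝ x' hx') =
        e.map ((trivializationAt E (TangentSpace I) x).linearEquivAt ℝ x
          (FiberBundle.mem_baseSet_trivializationAt' x)) := by
  refine ⟨(e.map ((trivializationAt E (TangentSpace I) x).linearEquivAt ℝ x
    (FiberBundle.mem_baseSet_trivializationAt' x))).map
    ((trivializationAt E (TangentSpace I) x).linearEquivAt ℝ x' hx').symm, fun i => ?_, ?_⟩
  · rfl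
  · ext i
    exact ((trivializationAt E (TangentSpace I) x).linearEquivAt ℝ x' hx').apply_symm_apply _

theorem extend_extChartAt_symm (x : M) (w : TangentSpace I x) {y : E}
    (hy : y ∈ (extChartAt I x).target) :
    FiberBundle.extend E w ((extChartAt I x).symm y) =
      mfderivWithin 𝓘(ℝ, E) I (extChartAt I x).symm (Set.range I) y w := by
  have hsrc : (extChartAt I x).symm y ∈ (chartAt H x).source := by
    simpa using (extChartAt I x).map_target hy
  have hL := TangentBundle.symmL_trivializationAt (𝕜 := ℝ) (I := I) hsrc
  rw [(extChartAt I x).right_inv hy] at hL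
  have hw : (trivializationAt E (TangentSpace I) x ⟨x, w⟩).2 = w := by
    have h1 := TangentBundle.continuousLinearMapAt_trivializationAt (𝕜 := ℝ) (I := I)
      (mem_chart_source H x)
    rw [mfderiv_extChartAt_self] at h1
    have h2 := congrArg (fun A => A w) h1
    refine Eq.trans ?_ h2
    rw [Trivialization.continuousLinearMapAt_apply, Trivialization.linearMapAt_apply,
      if_pos (FiberBundle.mem_baseSet_trivializationAt' x)]
  have h3 := congrArg (fun A => A (trivializationAt E (TangentSpace I) x ⟨x, w⟩).2) hL
  refine Eq.trans ?_ (h3.trans ?_)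
  · rw [Trivialization.symmL_apply _ (by simpa using hsrc)]
    rfl
  · exact congrArg _ hw

theorem formInChart_interior {k : ℕ} (u : (x : M) → TangentSpace I x) (η : DiffForm I M (k + 1))
    (x : M) {y : E} (hy : y ∈ (extChartAt I x).target) :
    formInChart I (interior u η) x y = (formInChart I η x y).curryLeft
      (VectorField.mpullbackWithin 𝓘(ℝ, E) I (extChartAt I x).symm u (Set.range I) y) := by
  have hinv := isInvertible_mfderivWithin_extChartAt_symm (I := I) hy
  have hu : mfderivWithin 𝓘(ℝ, E) I (extChartAt I x).symm (Set.range I) y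
      (VectorField.mpullbackWithin 𝓘(ℝ, E) I (extChartAt I x).symm u (Set.range I) y)
      = u ((extChartAt I x).symm y) := by
    rw [VectorField.mpullbackWithin_apply]
    exact hinv.self_apply_inverse _
  ext v
  change η ((extChartAt I x).symm y) (Matrix.vecCons (u ((extChartAt I x).symm y)) fun i =>
      mfderivWithin 𝓘(ℝ, E) I (extChartAt I x).symm (Set.range I) y (v i)) =
    η ((extChartAt I x).symm y) fun i => mfderivWithin 𝓘(ℝ, E) I (extChartAt I x).symm
      (Set.range I) y (Matrix.vecCons (VectorField.mpullbackWithin 𝓘(ℝ, E) I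
        (extChartAt I x).symm u (Set.range I) y) v i)
  congr 1
  funext i
  refine Fin.cases ?_ (fun i => ?_) i
  · exact hu.symm
  · rfl

theorem mpullbackWithin_extend (x : M) (w : TangentSpace I x) {y : E}
    (hy : y ∈ (extChartAt I x).target) :
    VectorField.mpullbackWithin 𝓘(ℝ, E) I (extChartAt I x).symm (FiberBundle.extend E w)
      (Set.range I) y = w := by
  have hinv := isInvertible_mfderivWithin_extChartAt_symm (I := I) hy
  rw [VectorField.mpullbackWithin_apply, extend_extChartAt_symm x w hy]
  exact hinv.inverse_apply_self _

theorem mlieBracket_extend (x : M) (w : TangentSpace I x) (u : (x : M) → TangentSpace I x) :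
    VectorField.mlieBracket I (FiberBundle.extend E w) u x =
      fderivWithin ℝ (VectorField.mpullbackWithin 𝓘(ℝ, E) I (extChartAt I x).symm u (Set.range I))
        (Set.range I) (extChartAt I x x) w := by
  let W : E → E := VectorField.mpullbackWithin 𝓘(ℝ, E) I (extChartAt I x).symm
    (FiberBundle.extend E w) (Set.range I)
  let U : E → E := VectorField.mpullbackWithin 𝓘(ℝ, E) I (extChartAt I x).symm u (Set.range I)
  have hW : W =ᶠ[𝓝[Set.range I] extChartAt I x x] fun _ => w :=
    Filter.eventuallyEq_of_mem (extChartAt_target_mem_nhdsWithin x)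
      fun y hy => mpullbackWithin_extend x w hy
  rw [VectorField.mlieBracket, VectorField.mlieBracketWithin_apply, mfderiv_extChartAt_self,
    Set.preimage_univ, Set.univ_inter]
  refine (congrArg (fun A : E →L[ℝ] E => A (VectorField.lieBracketWithin ℝ W U (Set.range I)
    (extChartAt I x x))) ContinuousLinearMap.inverse_id).trans ?_
  change fderivWithin ℝ U (Set.range I) (extChartAt I x x) (W (extChartAt I x x)) -
    fderivWithin ℝ W (Set.range I) (extChartAt I x x) (U (extChartAt I x x)) =
      fderivWithin ℝ U (Set.range I) (extChartAt I x x) w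
  have hW' : fderivWithin ℝ W (Set.range I) (extChartAt I x x) = 0 :=
    (hW.fderivWithin_eq_of_mem (𝕜 := ℝ) (Set.mem_range_self _)).trans (fderivWithin_const_apply _)
  rw [hW', hW.self_of_nhdsWithin (Set.mem_range_self _)]
  exact sub_zero _

variable [RiemannianBundle (fun x : M => TangentSpace I x)]

theorem hasFDerivWithinAt_inner_extend
    [IsContMDiffRiemannianBundle I ∞ E (fun x : M => TangentSpace I x)]
    (x : M) (v w : TangentSpace I x) :
    HasFDerivWithinAt (fun y : E => inner ℝ (FiberBundle.extend E v ((extChartAt I x).symm y))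
        (FiberBundle.extend E w ((extChartAt I x).symm y)))
      (mvfderiv I (fun x' => inner ℝ (FiberBundle.extend E v x') (FiberBundle.extend E w x')) x :
        E →L[ℝ] ℝ) (Set.range I) (extChartAt I x x) := by
  have hv := FiberBundle.mdifferentiableAt_extend I E v
  have hw := FiberBundle.mdifferentiableAt_extend I E w
  have h := (@MDifferentiableAt.inner_bundle E _ _ H _ I M _ _ E _ _
    (fun x : M => TangentSpace I x) _ (fun _ => inferInstance) (fun _ => inferInstance)
    _ _ E _ _ H _ I M _ _ _ id _ _ x hv hw).hasMFDerivAt.2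
  exact h

variable {m : ℕ} [Fact (finrank ℝ E = m + 1)]

theorem volForm_orthonormalBasis (o : ManifoldOrientation I M (m + 1)) (x : M)
    (e : OrthonormalBasis (Fin (m + 1)) ℝ (TangentSpace I x))
    (he : e.toBasis.orientation = o.at_point x) : volForm o x e = 1 := by
  have h1 : (o.at_point x).volumeForm = e.toBasis.det := (o.at_point x).volumeForm_robust e he
  change (o.at_point x).volumeForm e = 1
  rw [h1, ← e.coe_toBasis]
  exact e.toBasis.det_self

theorem formInChart_volForm_eq_smul (o : ManifoldOrientation I M (m + 1)) (x : M)
    (e : OrthonormalBasis (Fin (m + 1)) ℝ (TangentSpace I x))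
    (he : e.toBasis.orientation = o.at_point x) {y : E} (hy : y ∈ (extChartAt I x).target) :
    formInChart I (volForm o) x y = volForm o ((extChartAt I x).symm y)
      (fun i => FiberBundle.extend E (e i) ((extChartAt I x).symm y)) •
        (volForm o x : E [⋀^Fin (m + 1)]→L[ℝ] ℝ) := by
  have he1 : volForm o x e = 1 := volForm_orthonormalBasis o x e he
  let b : Basis (Fin (m + 1)) ℝ E := e.toBasis
  have hb : ∀ i, b i = e i := fun i => congrFun e.coe_toBasis i
  have hL : formInChart I (volForm o) x y b = volForm o ((extChartAt I x).symm y)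
      (fun i => FiberBundle.extend E (e i) ((extChartAt I x).symm y)) := by
    refine congrArg (volForm o ((extChartAt I x).symm y)) (funext fun i => ?_)
    refine Eq.trans ?_ (extend_extChartAt_symm x (e i) hy).symm
    exact congrArg _ (hb i)
  have hR : (volForm o x : E [⋀^Fin (m + 1)]→L[ℝ] ℝ) b = 1 :=
    (congrArg (volForm o x) (funext hb)).trans he1
  exact (ContinuousAlternatingMap.eq_apply_basis_smul b _ _ hR).trans
    (congrArg (fun r : ℝ => r • (volForm o x : E [⋀^Fin (m + 1)]→L[ℝ] ℝ)) hL)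

theorem volForm_extend_eventuallyEq (o : ManifoldOrientation I M (m + 1)) (x : M)
    (e : Basis (Fin (m + 1)) ℝ (TangentSpace I x)) (he : e.orientation = o.at_point x) :
    ∀ᶠ x' in 𝓝 x, volForm o x' (fun i => FiberBundle.extend E (e i) x') =
      Real.sqrt (Matrix.gram ℝ fun i => FiberBundle.extend E (e i) x').det := by
  obtain ⟨o₀, ho₀⟩ := o.locally_constant x
  have hself := ho₀.self_of_nhds (FiberBundle.mem_baseSet_trivializationAt' x)
  filter_upwards [ho₀, (trivializationAt E (TangentSpace I) x).open_baseSet.mem_nhds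
    (FiberBundle.mem_baseSet_trivializationAt' x)] with x' hx'o hx'
  obtain ⟨v, hv, hvmap⟩ := exists_basis_extend x e hx'
  have hor : v.orientation = o.at_point x' := by
    apply (Orientation.map (Fin (m + 1))
      ((trivializationAt E (TangentSpace I) x).linearEquivAt ℝ x' hx')).injective
    rw [hx'o hx', ← Basis.orientation_map, hvmap, Basis.orientation_map, he, hself]
  have hfun : (fun i => FiberBundle.extend E (e i) x') = v := funext fun i => (hv i).symm
  rw [hfun]
  exact (o.at_point x').volumeForm_eq_sqrt_det_gram m.succ_pos v hor

variable [IsContMDiffRiemannianBundle I ∞ E (fun x : M => TangentSpace I x)]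
  [FiniteDimensional ℝ E]

/-- In the chart at `x`, the volume form applied to the extension of an oriented orthonormal basis
`e` has derivative `v ↦ ∑ i, ⟪e i, ∇_v (extend (e i))⟫` at `x`. -/
theorem hasFDerivWithinAt_volForm_extend (o : ManifoldOrientation I M (m + 1))
    {nabla : CovariantDerivative I E (fun x : M => TangentSpace I x)}
    (hnabla : IsLeviCivita nabla) (x : M)
    (e : OrthonormalBasis (Fin (m + 1)) ℝ (TangentSpace I x))
    (he : e.toBasis.orientation = o.at_point x) :
    ∃ l : E →L[ℝ] ℝ, HasFDerivWithinAt (fun y : E => volForm o ((extChartAt I x).symm y)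
        (fun i => FiberBundle.extend E (e i) ((extChartAt I x).symm y)))
        l (Set.range I) (extChartAt I x x) ∧
      ∀ v : TangentSpace I x, l v = ∑ i, inner ℝ (e i) (nabla (FiberBundle.extend E (e i)) x v) := by
  have hgram : (Matrix.gram ℝ fun i => FiberBundle.extend E (e i)
      ((extChartAt I x).symm (extChartAt I x x))) = 1 := by
    rw [extChartAt_to_inv]
    simp only [FiberBundle.extend_apply_self]
    ext i j
    rw [Matrix.gram_apply, e.inner_eq_ite, Matrix.one_apply]
  have hdet := HasFDerivWithinAt.matrix_det_of_eq_one
    (a := fun y => Matrix.gram ℝ fun i => FiberBundle.extend E (e i) ((extChartAt I x).symm y))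
    (fun i j => hasFDerivWithinAt_inner_extend x (e i) (e j)) hgram
  have hsqrt := hdet.sqrt (by rw [hgram]; simp)
  have hev : ∀ᶠ y in 𝓝[Set.range I] extChartAt I x x,
      volForm o ((extChartAt I x).symm y)
        (fun i => FiberBundle.extend E (e i) ((extChartAt I x).symm y)) =
      Real.sqrt (Matrix.gram ℝ fun i =>
        FiberBundle.extend E (e i) ((extChartAt I x).symm y)).det := by
    have hcont : Filter.Tendsto (extChartAt I x).symm (𝓝[Set.range I] extChartAt I x x) (𝓝 x) := by
      have h := (continuousAt_extChartAt_symm (I := I) x).tendsto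
      rw [extChartAt_to_inv] at h
      exact h.mono_left nhdsWithin_le_nhds
    have h := hcont.eventually (volForm_extend_eventuallyEq o x e.toBasis he)
    simpa only [OrthonormalBasis.coe_toBasis] using h
  refine ⟨_, hsqrt.congr_of_eventuallyEq hev
    (hev.self_of_nhdsWithin (Set.mem_range_self _)), fun v => ?_⟩
  have hmetric : ∀ i, mvfderiv I (fun x' => inner ℝ (FiberBundle.extend E (e i) x')
      (FiberBundle.extend E (e i) x')) x v
      = 2 * inner ℝ (e i) (nabla (FiberBundle.extend E (e i)) x v) := by
    intro i
    have h := hnabla.1.mvfderiv_inner_eq (FiberBundle.extend E v)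
      (FiberBundle.mdifferentiableAt_extend I E (e i))
      (FiberBundle.mdifferentiableAt_extend I E (e i))
    simp only [FiberBundle.extend_apply_self] at h
    rw [h, real_inner_comm]
    ring
  rw [hgram]
  simp only [Matrix.det_one, Real.sqrt_one, mul_one]
  refine Eq.trans (b := (1 / 2 : ℝ) * ∑ i, mvfderiv I (fun x' => inner ℝ
    (FiberBundle.extend E (e i) x') (FiberBundle.extend E (e i) x')) x v) ?_ ?_
  · exact congrArg (fun r : ℝ => 1 / 2 * r) (sum_apply Finset.univ
      (fun i => (mvfderiv I (fun x' => inner ℝ (FiberBundle.extend E (e i) x')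
        (FiberBundle.extend E (e i) x')) x : E →L[ℝ] ℝ)) v)
  · simp_rw [hmetric, ← Finset.mul_sum]
    ring

/-- The divergence of a vector field is the trace of its Levi-Civita covariant derivative. -/
theorem divergence_eq_trace (o : ManifoldOrientation I M (m + 1))
    {nabla : CovariantDerivative I E (fun x : M => TangentSpace I x)}
    (hnabla : IsLeviCivita nabla) {u : (x : M) → TangentSpace I x} {x : M}
    (hu : MDifferentiableAt I I.tangent (fun x => (⟨x, u x⟩ : TangentBundle I M)) x) :
    divergence o u x = LinearMap.trace ℝ (TangentSpace I x) (nabla u x) := by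
  let e := (o.at_point x).finOrthonormalBasis m.succ_pos Fact.out
  have he : e.toBasis.orientation = o.at_point x :=
    (o.at_point x).finOrthonormalBasis_orientation _ _
  obtain ⟨l, hl, hlsum⟩ := hasFDerivWithinAt_volForm_extend o hnabla x e he
  set U : E → E := VectorField.mpullbackWithin 𝓘(ℝ, E) I (extChartAt I x).symm u (Set.range I)
    with hU
  have hUx : U (extChartAt I x x) = u x := by
    rw [hU, VectorField.mpullbackWithin_apply, mfderivWithin_range_extChartAt_symm]
    refine (congrArg (fun A : E →L[ℝ] E => A (u ((extChartAt I x).symm (extChartAt I x x))))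
      ContinuousLinearMap.inverse_id).trans ?_
    change u ((extChartAt I x).symm (extChartAt I x x)) = u x
    rw [extChartAt_to_inv]
  have hUd : HasFDerivWithinAt U (fderivWithin ℝ U (Set.range I) (extChartAt I x x))
      (Set.range I) (extChartAt I x x) := by
    have h := (mdifferentiableWithinAt_univ.2
      hu).differentiableWithinAt_mpullbackWithin_vectorField
    rw [Set.preimage_univ, Set.univ_inter] at h
    exact h.hasFDerivWithinAt
  have he1 : volForm o x e = 1 := volForm_orthonormalBasis o x e he
  have hform : formInChart I (interior u (volForm o)) x =ᶠ[𝓝[Set.range I] extChartAt I x x]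
      fun y => volForm o ((extChartAt I x).symm y)
        (fun i => FiberBundle.extend E (e i) ((extChartAt I x).symm y)) •
          (volForm o x : E [⋀^Fin (m + 1)]→L[ℝ] ℝ).curryLeft (U y) := by
    refine Filter.eventuallyEq_of_mem (extChartAt_target_mem_nhdsWithin x) fun y hy => ?_
    rw [formInChart_interior u _ x hy, formInChart_volForm_eq_smul o x e he hy]
    rfl
  have hval : extDerivWithin (formInChart I (interior u (volForm o)) x) (Set.range I)
      (extChartAt I x x) = (LinearMap.trace ℝ E (fderivWithin ℝ U (Set.range I)
        (extChartAt I x x)) + l (U (extChartAt I x x))) •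
          (volForm o x : E [⋀^Fin (m + 1)]→L[ℝ] ℝ) := by
    rw [hform.extDerivWithin_eq_of_mem (Set.mem_range_self _)]
    refine extDerivWithin_smul_curryLeft (E := E) (e.toBasis : Basis (Fin (m + 1)) ℝ E)
      (volForm o x : E [⋀^Fin (m + 1)]→L[ℝ] ℝ)
      (I.uniqueDiffOn.uniqueDiffWithinAt (Set.mem_range_self _)) hl hUd ?_
    rw [extChartAt_to_inv]
    simpa only [FiberBundle.extend_apply_self] using he1
  have hdiv : divergence o u x = LinearMap.trace ℝ E (fderivWithin ℝ U (Set.range I)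
      (extChartAt I x x)) + l (U (extChartAt I x x)) := by
    have h1 := congrArg (fun η => η e) (congrFun (extDerivM_interior_volForm o u) x)
    have h2 : extDerivM (interior u (volForm o)) x e = (LinearMap.trace ℝ E
        (fderivWithin ℝ U (Set.range I) (extChartAt I x x)) + l (U (extChartAt I x x))) *
          volForm o x e := by
      rw [extDerivM, hval, mfderiv_extChartAt_self]
      rfl
    have h3 : extDerivM (interior u (volForm o)) x e = divergence o u x * volForm o x e := h1
    rw [h2, he1, mul_one, mul_one] at h3
    exact h3.symm
  let D : TangentSpace I x →L[ℝ] TangentSpace I x :=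
    fderivWithin ℝ U (Set.range I) (extChartAt I x x)
  have htorsion : ∀ i, nabla u x (e i) = nabla (FiberBundle.extend E (e i)) x (u x) + D (e i) := by
    intro i
    have h := nabla.torsion_eq_zero_iff.1 hnabla.2
      (FiberBundle.mdifferentiableAt_extend I E (e i)) hu
    rw [FiberBundle.extend_apply_self, mlieBracket_extend] at h
    exact sub_eq_iff_eq_add'.1 h
  have htr := LinearMap.trace_eq_sum_inner D.toLinearMap e
  rw [hdiv, hUx, hlsum, LinearMap.trace_eq_sum_inner _ e]
  simp only [ContinuousLinearMap.coe_coe, htorsion, inner_add_right, Finset.sum_add_distrib]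
  rw [add_comm]
  exact congrArg _ htr

end
end RiemForms

theorem proposition2
    {m : ℕ}
    {E : Type*} [NormedAddCommGroup E] [NormedSpace ℝ E] [FiniteDimensional ℝ E]
    [Fact (Module.finrank ℝ E = m + 1)]
    {H : Type*} [TopologicalSpace H] (I : ModelWithCorners ℝ E H)
    {M : Type*} [TopologicalSpace M] [ChartedSpace H M] [IsManifold I ∞ M]
    [RiemannianBundle (fun x : M => TangentSpace I x)]
    [IsContMDiffRiemannianBundle I ∞ E (fun x : M => TangentSpace I x)]
    (o : RiemForms.ManifoldOrientation I M (m + 1))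
    (nabla : CovariantDerivative I E (fun x : M => TangentSpace I x))
    (hnabla : RiemForms.IsLeviCivita nabla)
    (f : M → ℝ) (hf : ContMDiff I 𝓘(ℝ, ℝ) 1 f)
    (u : (x : M) → TangentSpace I x)
    (hu : ContMDiff I I.tangent 1 (fun x => (⟨x, u x⟩ : TangentBundle I M))) :
    RiemForms.dotWedge (nabla u) (RiemForms.topToCovector (RiemForms.funMul f (RiemForms.volForm o)))
      = RiemForms.funMul (fun x => f x * RiemForms.divergence o u x) (RiemForms.volForm o) := by
  funext x
  have hdiv := RiemForms.divergence_eq_trace o hnabla (hu.mdifferentiableAt one_ne_zero (x := x))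
  have h := ContinuousAlternatingMap.alternatizeUncurryFin_curryLeft_comp_eq_trace_smul
    (finBasisOfFinrankEq ℝ E Fact.out)
    (f x • RiemForms.volForm o x : E [⋀^Fin (m + 1)]→L[ℝ] ℝ) (nabla u x : E →L[ℝ] E)
  refine Eq.trans h ?_
  change _ = (f x * RiemForms.divergence o u x) • RiemForms.volForm o x
  rw [hdiv, mul_comm, mul_smul]
  rfl
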